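/- Consider a single-qubit 4-element rank-1 POVM, i.e. operators $\Pi_{b}=|\varphi_{b}\rangle\langle\varphi_{b}|$ on $\mathbb{C}^2$, labelled by $b=(b_A,b_S)\in\{0,1\}^2$, with (subnormalized) vectors $|\varphi_b\rangle$ and $\sum_b\Pi_b=I$. (Informational completeness is not required; in particular every single-qubit minimal IC-POVM with rank-1 elements is included.) Let $U_{\mathrm P}\in U(4)$ be any unitary on $\mathbb{C}^2\otimes\mathbb{C}^2$ (auxiliary qubit $\otimes$ system qubit) that realizes the POVM: for all density operators $\rho$ on $\mathbb{C}^2$ and all $b$, $$\langle b|\,U_{\mathrm P}\,(|0\rangle\langle 0|\otimes\rho)\,U_{\mathrm P}^{\dagger}\,|b\rangle=\operatorname{tr}(\rho\,\Pi_b).$$ For real parameters $\gamma_0,\dots,\gamma_3$ and $\beta_1,\beta_2,\beta_3$ put $$Q=e^{\mathrm i\gamma_0}R_x(\gamma_1)R_z(\gamma_2)R_x(\gamma_3),\quad C_Q=\begin{pmatrix}I&0\\0&Q\end{pmatrix},\quad U_{\mathrm{ph}}=C_{R_z}(\beta_3)\,\bigl(R_z(\beta_1)\otimes R_z(\beta_2)\bigr),$$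 where $R_x(\theta)=e^{-\mathrm i\theta X/2}$, $R_z(\beta)=\operatorname{diag}(1,e^{\mathrm i\beta})$ and $C_{R_z}(\beta)=\operatorname{diag}(1,1,1,e^{\mathrm i\beta})$. Then the parameters $\gamma_0,\dots,\gamma_3,\beta_1,\beta_2,\beta_3$ can be chosen so that the unitary $U_{\mathrm P}'=U_{\mathrm{ph}}\,U_{\mathrm P}\,C_Q$ realizes the same POVM $\{\Pi_b\}$ and is the product of a circuit consisting of single-qubit gates and exactly $2$ CNOT gates. -/

import Mathlib

open scoped Matrix Kronecker ComplexOrder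

noncomputable section

namespace QubitPOVM

/-- Operators on one qubit, in the computational basis. -/
abbrev Op1 : Type := Matrix (Fin 2) (Fin 2) ℂ

/-- Operators on two qubits, in the computational basis. The first index is the auxiliary qubit,
the second one the system qubit. -/
abbrev Op2 : Type := Matrix (Fin 2 × Fin 2) (Fin 2 × Fin 2) ℂ

/-! ### POVMs and their dilations -/

/-- A discrete POVM on a `d`-dimensional Hilbert space. -/
structure IsPOVM {ι d : Type*} [Fintype ι] [Fintype d] [DecidableEq d]
    (P : ι → Matrix d d ℂ) : Prop where
  posSemidef : ∀ i, (P i).PosSemidef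
  sum_eq_one : ∑ i, P i = 1

/-- A POVM whose elements are `P i = |φ i⟩⟨φ i|` with subnormalized vectors `φ i`. A vanishing
`φ i` is not excluded, so this covers all POVMs with elements of rank exactly one. -/
structure IsRankOnePOVM {ι d : Type*} [Fintype ι] [Fintype d] [DecidableEq d]
    (P : ι → Matrix d d ℂ) : Prop extends IsPOVM P where
  rank_one : ∀ i, ∃ φ : d → ℂ, P i = Matrix.vecMulVec φ (star φ)

/-- Density operators. -/
structure IsDensity {d : Type*} [Fintype d] (ρ : Matrix d d ℂ) : Prop where
  posSemidef : ρ.PosSemidef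
  trace_eq_one : ρ.trace = 1

/-- The probability of the outcome `b = (b_A, b_S)` when the auxiliary qubit starts in `|0⟩`, the
system qubit in `ρ`, the two-qubit unitary `U` is applied and both qubits are measured in the
computational basis: `⟨b| U (|0⟩⟨0| ⊗ ρ) U† |b⟩`. -/
def outcomeProb (U : Op2) (ρ : Op1) (b : Fin 2 × Fin 2) : ℂ :=
  (U * ((Matrix.single 0 0 1 : Op1) ⊗ₖ ρ) * Uᴴ) b b

/-- `U` is a two-qubit unitary that realizes the four-element qubit POVM `P`, whose elements are
labelled by the outcomes of the joint measurement of both qubits. -/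
structure IsDilation (U : Op2) (P : Fin 2 × Fin 2 → Op1) : Prop where
  unitary : U ∈ Matrix.unitaryGroup (Fin 2 × Fin 2) ℂ
  prob_eq : ∀ ρ : Op1, IsDensity ρ → ∀ b, outcomeProb U ρ b = (ρ * P b).trace

/-! ### Gates -/

/-- The rotation `exp (-i θ X / 2)`. -/
def Rx (θ : ℝ) : Op1 :=
  !![(Real.cos (θ / 2) : ℂ), -Complex.I * (Real.sin (θ / 2) : ℂ);
     -Complex.I * (Real.sin (θ / 2) : ℂ), (Real.cos (θ / 2) : ℂ)]

/-- The phase gate `diag (1, exp (i β))`. -/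
def Rz (β : ℝ) : Op1 :=
  !![1, 0; 0, Complex.exp (Complex.I * β)]

/-- The Pauli operator `X`. -/
def pauliX : Op1 := !![0, 1; 1, 0]

/-- The controlled gate `|0⟩⟨0| ⊗ I + |1⟩⟨1| ⊗ Q`: the auxiliary qubit controls, `Q` acts on the
system qubit. As a block matrix it is `diag (I, Q)`. -/
def controlled (Q : Op1) : Op2 :=
  (Matrix.single 0 0 1 : Op1) ⊗ₖ (1 : Op1) + (Matrix.single 1 1 1 : Op1) ⊗ₖ Q

/-- `Q = exp (i γ₀) R_x (γ₁) R_z (γ₂) R_x (γ₃)`. -/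
def gateQ (γ : Fin 4 → ℝ) : Op1 :=
  Complex.exp (Complex.I * γ 0) • (Rx (γ 1) * Rz (γ 2) * Rx (γ 3))

/-- The row phases `C_{R_z} (β₃) (R_z (β₁) ⊗ R_z (β₂))`; the entries of `β` are
`β₁, β₂, β₃` in this order. -/
def gatePh (β : Fin 3 → ℝ) : Op2 :=
  controlled (Rz (β 2)) * (Rz (β 0) ⊗ₖ Rz (β 1))

/-- The circuit that varies the parameters irrelevant to the POVM around the reference `U`:
first `C_Q`, then `U`, then the row phases. -/
def adjust (U : Op2) (γ : Fin 4 → ℝ) (β : Fin 3 → ℝ) : Op2 :=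
  gatePh β * U * controlled (gateQ γ)

/-! ### Two-qubit circuits and their CNOT count -/

/-- The gate set: all single-qubit gates, and the CNOT gates in both orientations. -/
inductive Gate : Type
  | onAux (G : Matrix.unitaryGroup (Fin 2) ℂ)
  | onSys (G : Matrix.unitaryGroup (Fin 2) ℂ)
  | cnotAuxSys
  | cnotSysAux

/-- The unitary of a gate. -/
def Gate.mat : Gate → Op2
  | .onAux G => (G : Op1) ⊗ₖ (1 : Op1)
  | .onSys G => (1 : Op1) ⊗ₖ (G : Op1)
  | .cnotAuxSys => controlled pauliX
  | .cnotSysAux =>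
      (1 : Op1) ⊗ₖ (Matrix.single 0 0 1 : Op1) + pauliX ⊗ₖ (Matrix.single 1 1 1 : Op1)

/-- The number of CNOT gates (0 or 1) in a gate. -/
def Gate.cnots : Gate → ℕ
  | .onAux _ => 0
  | .onSys _ => 0
  | .cnotAuxSys => 1
  | .cnotSysAux => 1

/-- The unitary of a circuit, given as a list of gates whose product is taken in the order of the
list, so that the last gate of the list is applied first. -/
def circuitMat (c : List Gate) : Op2 := (c.map Gate.mat).prod

/-- The number of CNOT gates in a circuit. -/
def cnotCount (c : List Gate) : ℕ := (c.map Gate.cnots).sum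

/-- `U` is compiled by a circuit of single-qubit gates and exactly `n` CNOT gates. Global phases
need no special treatment, since the single-qubit gates range over all of `U(2)`. -/
def CompilesWith (n : ℕ) (U : Op2) : Prop :=
  ∃ c : List Gate, circuitMat c = U ∧ cnotCount c = n

end QubitPOVM

end

namespace QubitPOVM

open Matrix Complex

/-! ### Controlled gates and local gates -/

/-! The auxiliary qubit starts in |0⟩, so a gate `controlled Q` applied first never acts
(`outcomeProb_mul_controlled`): the POVM depends only on the columns (0,0) and (0,1) of `U`. By
Euler angles `gateQ` reaches every `Q` in U(2) (`exists_gateQ_eq`), and the row phases can be left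
at zero. It remains to show that any two-qubit unitary takes two CNOTs up to such a `Q`
(`compilesUpToControlled_two_of_mem_unitaryGroup`).

The two columns span a plane in ℂ² ⊗ ℂ². The determinant is a quadratic form there, so some unit
vector of the plane is a product vector. A system gate on the right makes it the first column, and
local gates on the left take it to a multiple of |00⟩. The second column then has entries only at
(0,1), (1,0), (1,1). One gate controlled by the auxiliary qubit removes (1,0), and one controlled by
the system qubit removes (1,1). Both use a conjugate of X and so cost one CNOT each. What remains is
a phase gate on the system qubit and a controlled gate, which `Q` cancels. -/

lemma controlled_mul (A B : Op1) : controlled A * controlled B = controlled (A * B) := by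
  ext ⟨i, j⟩ ⟨k, l⟩
  fin_cases i <;> fin_cases j <;> fin_cases k <;> fin_cases l <;>
    simp [controlled, Matrix.mul_apply, Fintype.sum_prod_type, Matrix.single, Matrix.one_apply]

lemma controlled_one : controlled 1 = 1 := by
  ext ⟨i, j⟩ ⟨k, l⟩
  fin_cases i <;> fin_cases j <;> fin_cases k <;> fin_cases l <;>
    simp [controlled, Matrix.single]

lemma conjTranspose_controlled (A : Op1) : (controlled A)ᴴ = controlled Aᴴ := by
  ext ⟨i, j⟩ ⟨k, l⟩
  fin_cases i <;> fin_cases j <;> fin_cases k <;> fin_cases l <;>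
    simp [controlled, Matrix.single, Matrix.conjTranspose_apply]

lemma controlled_mem_unitaryGroup {Q : Op1} (hQ : Q ∈ unitaryGroup (Fin 2) ℂ) :
    controlled Q ∈ unitaryGroup (Fin 2 × Fin 2) ℂ := by
  rw [mem_unitaryGroup_iff, star_eq_conjTranspose, conjTranspose_controlled, controlled_mul,
    ← star_eq_conjTranspose, mem_unitaryGroup_iff.1 hQ, controlled_one]

lemma controlled_mul_single (Q ρ : Op1) :
    controlled Q * ((Matrix.single 0 0 1 : Op1) ⊗ₖ ρ) = (Matrix.single 0 0 1 : Op1) ⊗ₖ ρ := by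
  ext ⟨i, j⟩ ⟨k, l⟩
  fin_cases i <;> fin_cases j <;> fin_cases k <;> fin_cases l <;>
    simp [controlled, Matrix.mul_apply, Fintype.sum_prod_type, Matrix.single, Matrix.one_apply]

lemma outcomeProb_mul_controlled (U : Op2) (Q ρ : Op1) (b : Fin 2 × Fin 2) :
    outcomeProb (U * controlled Q) ρ b = outcomeProb U ρ b := by
  have h1 := controlled_mul_single Q ρ
  have h2 : ((Matrix.single 0 0 1 : Op1) ⊗ₖ ρ) * (controlled Q)ᴴ
      = (Matrix.single 0 0 1 : Op1) ⊗ₖ ρ := by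
    have := congrArg conjTranspose (controlled_mul_single Q ρᴴ)
    simpa [conjTranspose_kronecker] using this
  unfold outcomeProb
  rw [conjTranspose_mul, Matrix.mul_assoc U, h1, Matrix.mul_assoc U, ← Matrix.mul_assoc _ _ Uᴴ, h2,
    Matrix.mul_assoc]

lemma IsDilation.mul_controlled {U : Op2} {P : Fin 2 × Fin 2 → Op1} (hU : IsDilation U P)
    {Q : Op1} (hQ : Q ∈ unitaryGroup (Fin 2) ℂ) : IsDilation (U * controlled Q) P where
  unitary := mul_mem hU.unitary (controlled_mem_unitaryGroup hQ)
  prob_eq ρ hρ b := by rw [outcomeProb_mul_controlled, hU.prob_eq ρ hρ b]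

lemma Rz_zero : Rz 0 = 1 := by
  ext i j
  fin_cases i <;> fin_cases j <;> simp [Rz]

lemma gatePh_zero : gatePh 0 = 1 := by
  simp [gatePh, Rz_zero, controlled_one]

/-! ### Euler angles -/

/-- A `2 × 2` unitary is determined by its first column and its determinant. -/
lemma exists_angles_of_mem_unitaryGroup {Q : Op1} (hQ : Q ∈ unitaryGroup (Fin 2) ℂ) :
    ∃ t a m d : ℝ, Q = !![Real.cos t * exp (I * a), -Real.sin t * exp (I * (d - m));
      Real.sin t * exp (I * m), Real.cos t * exp (I * (d - a))] := by
  have h1 : Qᴴ * Q = 1 := mem_unitaryGroup_iff'.1 hQ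
  have h2 : Q * Qᴴ = 1 := mem_unitaryGroup_iff.1 hQ
  -- Comparing adjugate and conjugate transpose expresses the second column through the first and
  -- the determinant.
  have hadj : Q.adjugate = Q.det • Qᴴ := by
    calc Q.adjugate = Q.adjugate * (Q * Qᴴ) := by rw [h2, Matrix.mul_one]
      _ = Q.det • Qᴴ := by
        rw [← Matrix.mul_assoc, adjugate_mul, Matrix.smul_mul, Matrix.one_mul]
  have hdet : ‖Q.det‖ = 1 := CStarRing.norm_of_mem_unitary (det_of_mem_unitary hQ)
  have hcol : ‖Q 0 0‖ ^ 2 + ‖Q 1 0‖ ^ 2 = 1 := by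
    have h := congrFun₂ h1 0 0
    simp only [Matrix.mul_apply, Fin.sum_univ_two, conjTranspose_apply, star_def,
      Matrix.one_apply_eq, conj_mul'] at h
    exact_mod_cast h
  have h01 : Q 0 1 = -(Q.det * star (Q 1 0)) := by
    have h := congrFun₂ hadj 0 1
    simp only [adjugate_fin_two, of_apply, cons_val', cons_val_zero, cons_val_one,
      cons_val_fin_one, Matrix.smul_apply, conjTranspose_apply, smul_eq_mul] at h
    rw [← h, neg_neg]
  have h11 : Q 1 1 = Q.det * star (Q 0 0) := by
    have h := congrFun₂ hadj 0 0
    simpa only [adjugate_fin_two, of_apply, cons_val', cons_val_zero, cons_val_one,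
      cons_val_fin_one, Matrix.smul_apply, conjTranspose_apply, smul_eq_mul] using h
  have hle : ‖Q 0 0‖ ≤ 1 := by nlinarith [norm_nonneg (Q 0 0), sq_nonneg ‖Q 1 0‖]
  have hcos : Real.cos (Real.arccos ‖Q 0 0‖) = ‖Q 0 0‖ :=
    Real.cos_arccos (by linarith [norm_nonneg (Q 0 0)]) hle
  have hsin : Real.sin (Real.arccos ‖Q 0 0‖) = ‖Q 1 0‖ := by
    rw [Real.sin_arccos, show 1 - ‖Q 0 0‖ ^ 2 = ‖Q 1 0‖ ^ 2 by linarith,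
      Real.sqrt_sq (norm_nonneg _)]
  have hpolar (z : ℂ) : (‖z‖ : ℂ) * exp (I * z.arg) = z := by
    rw [mul_comm I, norm_mul_exp_arg_mul_I]
  have hpolar' (z : ℂ) : (‖z‖ : ℂ) * exp (-(I * z.arg)) = star z := by
    conv_rhs => rw [← hpolar z]
    simp [← Complex.exp_conj]
  have hD : exp (I * Q.det.arg) = Q.det := by
    conv_rhs => rw [← hpolar Q.det, hdet, ofReal_one, one_mul]
  refine ⟨Real.arccos ‖Q 0 0‖, (Q 0 0).arg, (Q 1 0).arg, Q.det.arg, ?_⟩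
  rw [hcos, hsin]
  ext i j
  fin_cases i <;> fin_cases j
  · simp [hpolar]
  · simp only [Fin.zero_eta, Fin.mk_one, h01, of_apply, cons_val', cons_val_zero, cons_val_one,
      cons_val_fin_one, sub_eq_add_neg, _root_.mul_add, mul_neg,
      Complex.exp_add, hD, ← hpolar' (Q 1 0)]
    ring
  · simp [hpolar]
  · simp only [Fin.mk_one, h11, of_apply, cons_val', cons_val_one,
      cons_val_fin_one, sub_eq_add_neg, _root_.mul_add, mul_neg,
      Complex.exp_add, hD, ← hpolar' (Q 0 0)]
    ring

/-- The unnormalized Hadamard matrix. -/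
def hadamard : Op1 := !![1, 1; 1, -1]

lemma hadamard_mul_self : hadamard * hadamard = (2 : ℂ) • (1 : Op1) := by
  ext i j
  fin_cases i <;> fin_cases j <;> norm_num [hadamard]

/-- The columns of `hadamard` are eigenvectors of X. Conjugation by it turns the X-Z-X product in
`gateQ` into diagonal · `Rx` · diagonal, whose entries are explicit. -/
lemma Rx_mul_hadamard (θ : ℝ) : Rx θ * hadamard =
    hadamard * !![exp (-(I * (θ / 2))), 0; 0, exp (I * (θ / 2))] := by
  have h1 : exp (I * (θ / 2)) = cos (θ / 2) + sin (θ / 2) * I := by rw [mul_comm, exp_mul_I]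
  have h2 : exp (-(I * (θ / 2))) = cos (θ / 2) - sin (θ / 2) * I := by
    rw [mul_comm, ← neg_mul, exp_mul_I, Complex.cos_neg, Complex.sin_neg]
    ring
  rw [h1, h2]
  ext i j
  fin_cases i <;> fin_cases j <;> simp [hadamard, Rx] <;> ring

lemma Rz_mul_hadamard (β : ℝ) :
    Rz β * hadamard = hadamard * (exp (I * (β / 2)) • Rx β) := by
  have h1 : exp (I * (β / 2)) = cos (β / 2) + sin (β / 2) * I := by rw [mul_comm, exp_mul_I]
  have h3 : exp (I * β) = exp (I * (β / 2)) * exp (I * (β / 2)) := by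
    rw [← exp_add]
    ring_nf
  have h4 := Complex.sin_sq_add_cos_sq ((β : ℂ) / 2)
  have h5 := I_sq
  ext i j
  fin_cases i <;> fin_cases j <;> simp [hadamard, Rx, Rz, h3, h1] <;> grind

lemma gateQ_mul_hadamard (γ : Fin 4 → ℝ) : gateQ γ * hadamard = hadamard *
    !![Real.cos (γ 2 / 2) * exp (I * (γ 0 + γ 2 / 2 - (γ 1 + γ 3) / 2)),
      -I * Real.sin (γ 2 / 2) * exp (I * (γ 0 + γ 2 / 2 - (γ 1 - γ 3) / 2));
      -I * Real.sin (γ 2 / 2) * exp (I * (γ 0 + γ 2 / 2 + (γ 1 - γ 3) / 2)),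
      Real.cos (γ 2 / 2) * exp (I * (γ 0 + γ 2 / 2 + (γ 1 + γ 3) / 2))] := by
  have h : gateQ γ * hadamard = hadamard * (exp (I * γ 0) •
      (!![exp (-(I * (γ 1 / 2))), 0; 0, exp (I * (γ 1 / 2))] * (exp (I * (γ 2 / 2)) • Rx (γ 2)) *
        !![exp (-(I * (γ 3 / 2))), 0; 0, exp (I * (γ 3 / 2))])) := by
    rw [gateQ, Matrix.smul_mul, Matrix.mul_assoc, Rx_mul_hadamard, Matrix.mul_smul,
      ← Matrix.mul_assoc, Matrix.mul_assoc _ (Rz _), Rz_mul_hadamard, ← Matrix.mul_assoc,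
      Rx_mul_hadamard]
    simp only [Matrix.mul_assoc]
  have hexp (a b c d e : ℂ) (x : ℂ) (h : a + b + c + d = e) :
      exp a * (exp b * (exp c * x) * exp d) = x * exp e := by
    rw [← h, Complex.exp_add, Complex.exp_add, Complex.exp_add]
    ring
  rw [h]
  congr 1
  ext i j
  fin_cases i <;> fin_cases j <;>
    simp only [Rx, Fin.zero_eta, Fin.mk_one, Matrix.smul_apply, smul_eq_mul, Matrix.mul_apply,
      Fin.sum_univ_two, of_apply, cons_val', cons_val_zero, cons_val_one, cons_val_fin_one,
      zero_mul, mul_zero, add_zero, zero_add] <;>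
    exact hexp _ _ _ _ _ _ (by ring)

lemma exists_gateQ_eq {Q : Op1} (hQ : Q ∈ unitaryGroup (Fin 2) ℂ) : ∃ γ, gateQ γ = Q := by
  have hH : hadamardᴴ = hadamard := by
    ext i j
    fin_cases i <;> fin_cases j <;> simp [hadamard]
  have hQ' : (1 / 2 : ℂ) • (hadamard * Q * hadamard) ∈ unitaryGroup (Fin 2) ℂ := by
    have h2 : Q * Qᴴ = 1 := mem_unitaryGroup_iff.1 hQ
    rw [mem_unitaryGroup_iff, star_eq_conjTranspose, conjTranspose_smul, conjTranspose_mul,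
      conjTranspose_mul, hH, Matrix.smul_mul, Matrix.mul_smul]
    calc _ = (1 / 2 : ℂ) • star (1 / 2 : ℂ) •
          (hadamard * (Q * (hadamard * hadamard) * Qᴴ) * hadamard) := by
            simp only [Matrix.mul_assoc]
      _ = 1 := by
        rw [hadamard_mul_self, Matrix.mul_smul, Matrix.mul_one, Matrix.smul_mul, h2,
          Matrix.mul_smul, Matrix.mul_one, Matrix.smul_mul, hadamard_mul_self, smul_smul,
          smul_smul, smul_smul]
        norm_num
  obtain ⟨t, a, m, d, h⟩ := exists_angles_of_mem_unitaryGroup hQ'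
  -- These angles solve the phase equations of `gateQ_mul_hadamard`; the shifts by π/2 absorb the
  -- factor -i of the off-diagonal entries.
  refine ⟨![d / 2 - t, m + Real.pi / 2 - a, 2 * t, d - a - m - Real.pi / 2], ?_⟩
  have hinj {A B : Op1} (hAB : A * hadamard = B * hadamard) : A = B := by
    have := congrArg (fun M => (1 / 2 : ℂ) • (M * hadamard)) hAB
    simpa [Matrix.mul_assoc, hadamard_mul_self, smul_smul] using this
  apply hinj
  have hR : Q * hadamard = hadamard * ((1 / 2 : ℂ) • (hadamard * Q * hadamard)) := by
    rw [Matrix.mul_smul, Matrix.mul_assoc, ← Matrix.mul_assoc hadamard, hadamard_mul_self,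
      Matrix.smul_mul, Matrix.one_mul, smul_smul]
    norm_num
  rw [hR, h, gateQ_mul_hadamard]
  congr 1
  have hm : exp (-(I * (Real.pi / 2))) = -I := by
    rw [mul_comm, ← neg_mul, ← neg_div, exp_neg_pi_div_two_mul_I]
  have hp : exp (I * (Real.pi / 2)) = I := by rw [mul_comm, exp_pi_div_two_mul_I]
  ext i j
  fin_cases i <;> fin_cases j
  · simp
    left
    ring_nf
  · have h : (d : ℂ) / 2 - (m + Real.pi / 2 - a - (d - a - m - Real.pi / 2)) / 2
        = d - m + -(Real.pi / 2) := by ring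
    simp
    rw [h, _root_.mul_add, mul_neg, Complex.exp_add, hm]
    linear_combination -sin t * exp (I * (d - m)) * I_sq
  · have h : (d : ℂ) / 2 + (m + Real.pi / 2 - a - (d - a - m - Real.pi / 2)) / 2
        = m + Real.pi / 2 := by ring
    simp
    rw [h, _root_.mul_add, Complex.exp_add, hp]
    linear_combination -sin t * exp (I * m) * I_sq
  · simp
    left
    ring_nf

/-! ### Single-qubit unitaries with prescribed action on a vector -/

lemma pauliX_mul_self : pauliX * pauliX = 1 := by
  ext i j
  fin_cases i <;> fin_cases j <;> simp [pauliX]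

lemma pauliX_mem_unitaryGroup : pauliX ∈ unitaryGroup (Fin 2) ℂ := by
  rw [mem_unitaryGroup_iff]
  ext i j
  fin_cases i <;> fin_cases j <;> simp [pauliX, star_eq_conjTranspose, Matrix.mul_apply]

lemma mem_unitaryGroup_of_normSq {x y : ℂ} (h : normSq x + normSq y = 1) :
    !![x, -star y; y, star x] ∈ unitaryGroup (Fin 2) ℂ := by
  have h' : x * star x + y * star y = 1 := by
    rw [star_def, mul_conj, mul_conj]
    exact_mod_cast h
  rw [star_def] at h'
  rw [mem_unitaryGroup_iff']
  ext i j
  fin_cases i <;> fin_cases j <;>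
    simp [star_eq_conjTranspose, Matrix.mul_apply, Fin.sum_univ_two] <;>
    first | linear_combination h' | ring

lemma conj_pauliX_mem_unitaryGroup {g : Op1} (hg : g ∈ unitaryGroup (Fin 2) ℂ) :
    g * pauliX * gᴴ ∈ unitaryGroup (Fin 2) ℂ :=
  mul_mem (mul_mem hg pauliX_mem_unitaryGroup) (star (⟨g, hg⟩ : unitaryGroup (Fin 2) ℂ)).2

/-- Up to a scalar, some conjugate of `X` takes a given vector to the first basis vector. -/
lemma exists_conj_pauliX_row_one (x y : ℂ) :
    ∃ g ∈ unitaryGroup (Fin 2) ℂ, (g * pauliX * gᴴ) 1 0 * x + (g * pauliX * gᴴ) 1 1 * y = 0 := by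
  -- The real problem with the moduli comes first: the row (cos 2t, sin 2t) is orthogonal to (‖x‖,
  -- ‖y‖) when 2t is the polar angle of that vector plus π/2.
  set w : ℂ := ⟨‖x‖, ‖y‖⟩ with hw
  have hx : ‖w‖ * Real.cos w.arg = ‖x‖ := norm_mul_cos_arg w
  have hy : ‖w‖ * Real.sin w.arg = ‖y‖ := norm_mul_sin_arg w
  set t : ℝ := (w.arg + Real.pi / 2) / 2 with ht
  have hc : Real.cos t ^ 2 - Real.sin t ^ 2 = -Real.sin w.arg := by
    rw [← Real.cos_two_mul', ht, mul_div_cancel₀ _ two_ne_zero, Real.cos_add_pi_div_two]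
  have hs : 2 * Real.sin t * Real.cos t = Real.cos w.arg := by
    rw [← Real.sin_two_mul, ht, mul_div_cancel₀ _ two_ne_zero, Real.sin_add_pi_div_two]
  have h1 : Real.cos t ^ 2 + Real.sin t ^ 2 = 1 := Real.cos_sq_add_sin_sq t
  have hxy : (Real.cos t ^ 2 - Real.sin t ^ 2) * ‖x‖ + 2 * Real.sin t * Real.cos t * ‖y‖ = 0 := by
    rw [hc, hs, ← hx, ← hy]
    ring
  generalize Real.cos t = u at h1 hxy
  generalize Real.sin t = v at h1 hxy
  have h1' : (u : ℂ) ^ 2 + v ^ 2 = 1 := by exact_mod_cast h1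
  have hxy' : ((u : ℂ) ^ 2 - v ^ 2) * ‖x‖ + 2 * v * u * ‖y‖ = 0 := by exact_mod_cast hxy
  -- The phase `p` aligns the two components, which reduces the complex equation to the real one.
  set p := exp (I * (x.arg - y.arg)) with hp
  set q := exp (-(I * (x.arg - y.arg))) with hq
  have hpq : p * q = 1 := by rw [hp, hq, ← Complex.exp_add, add_neg_cancel, Complex.exp_zero]
  have hstar : (starRingEnd ℂ) p = q := by simp [hp, hq, ← Complex.exp_conj]
  have hqx : q * x = ‖x‖ * exp (y.arg * I) := by
    conv_lhs => rw [← norm_mul_exp_arg_mul_I x]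
    rw [mul_left_comm, hq, ← Complex.exp_add]
    ring_nf
  refine ⟨!![p * u, -(p * v); v, u], ?_, ?_⟩
  · rw [mem_unitaryGroup_iff]
    ext i j
    fin_cases i <;> fin_cases j <;>
      simp [star_eq_conjTranspose, Matrix.mul_apply, Fin.sum_univ_two, hstar]
    · linear_combination p * q * h1' + hpq
    · ring
    · ring
    · linear_combination h1'
  · simp [pauliX, Matrix.mul_apply, Fin.sum_univ_two, hstar]
    conv_lhs => rw [← norm_mul_exp_arg_mul_I y]
    linear_combination ((u : ℂ) ^ 2 - v ^ 2) * hqx + exp (y.arg * I) * hxy'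

/-- Up to a scalar, some conjugate of `X` takes a given vector to the second basis vector. -/
lemma exists_conj_pauliX_row_zero (x y : ℂ) :
    ∃ g ∈ unitaryGroup (Fin 2) ℂ, (g * pauliX * gᴴ) 0 0 * x + (g * pauliX * gᴴ) 0 1 * y = 0 := by
  obtain ⟨g, hg, h⟩ := exists_conj_pauliX_row_one y x
  -- The extra factor X interchanges both the rows and the columns of the conjugate.
  refine ⟨pauliX * g, mul_mem pauliX_mem_unitaryGroup hg, ?_⟩
  have hX : pauliXᴴ = pauliX := by
    ext i j
    fin_cases i <;> fin_cases j <;> simp [pauliX]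
  have : pauliX * g * pauliX * (pauliX * g)ᴴ = pauliX * (g * pauliX * gᴴ) * pauliX := by
    rw [conjTranspose_mul, hX]
    simp only [Matrix.mul_assoc]
  rw [this, ← h]
  generalize g * pauliX * gᴴ = G
  rw [eta_fin_two G]
  simp [pauliX, add_comm]

/-! ### Compilation up to a controlled gate applied first -/

/-- `U` can be compiled with `n` CNOT gates after a suitable controlled gate is applied first. -/
def CompilesUpToControlled (n : ℕ) (U : Op2) : Prop :=
  ∃ Q ∈ unitaryGroup (Fin 2) ℂ, CompilesWith n (U * controlled Q)

lemma CompilesUpToControlled.gate_mul {n : ℕ} {U : Op2} (h : CompilesUpToControlled n U)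
    (G : Gate) : CompilesUpToControlled (G.cnots + n) (G.mat * U) := by
  obtain ⟨Q, hQ, c, hc, hn⟩ := h
  refine ⟨Q, hQ, G :: c, ?_, ?_⟩
  · simp only [circuitMat, List.map_cons, List.prod_cons] at hc ⊢
    rw [hc, Matrix.mul_assoc]
  · simp only [cnotCount, List.map_cons, List.sum_cons] at hn ⊢
    rw [hn]

/-- A system gate passes through `controlled Q` at the price of conjugating `Q`, so the two relevant
columns may be mixed freely. -/
lemma CompilesUpToControlled.mul_onSys {n : ℕ} {U : Op2} (h : CompilesUpToControlled n U)
    (g : unitaryGroup (Fin 2) ℂ) : CompilesUpToControlled n (U * (Gate.onSys g).mat) := by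
  obtain ⟨Q, hQ, c, hc, hn⟩ := h
  refine ⟨star (g : Op1) * Q * g, mul_mem (mul_mem (star g).2 hQ) g.2, c ++ [.onSys g], ?_, ?_⟩
  · have hg : (g : Op1) * star (g : Op1) = 1 := mem_unitaryGroup_iff.1 g.2
    have key : (1 : Op1) ⊗ₖ (g : Op1) * controlled (star (g : Op1) * Q * g)
        = controlled Q * ((1 : Op1) ⊗ₖ (g : Op1)) := by
      simp only [controlled, Matrix.mul_add, Matrix.add_mul, ← mul_kronecker_mul, Matrix.one_mul,
        Matrix.mul_one, ← Matrix.mul_assoc, hg]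
    simp only [circuitMat, List.map_append, List.prod_append, List.map_cons, List.map_nil,
      List.prod_cons, List.prod_nil, mul_one, Gate.mat] at hc ⊢
    rw [hc, Matrix.mul_assoc, Matrix.mul_assoc, key]
  · simp only [cnotCount, List.map_append, List.sum_append] at hn ⊢
    simp [hn, Gate.cnots]

lemma onAux_star_mul (g : unitaryGroup (Fin 2) ℂ) (U : Op2) :
    (Gate.onAux (star g)).mat * ((Gate.onAux g).mat * U) = U := by
  have : star (g : Op1) * (g : Op1) = 1 := mem_unitaryGroup_iff'.1 g.2
  rw [← Matrix.mul_assoc]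
  simp [Gate.mat, ← mul_kronecker_mul, this]

lemma onSys_star_mul (g : unitaryGroup (Fin 2) ℂ) (U : Op2) :
    (Gate.onSys (star g)).mat * ((Gate.onSys g).mat * U) = U := by
  have : star (g : Op1) * (g : Op1) = 1 := mem_unitaryGroup_iff'.1 g.2
  rw [← Matrix.mul_assoc]
  simp [Gate.mat, ← mul_kronecker_mul, this]

lemma mul_onSys_star (g : unitaryGroup (Fin 2) ℂ) (U : Op2) :
    U * (Gate.onSys g).mat * (Gate.onSys (star g)).mat = U := by
  have : (g : Op1) * star (g : Op1) = 1 := mem_unitaryGroup_iff.1 g.2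
  rw [Matrix.mul_assoc]
  simp [Gate.mat, ← mul_kronecker_mul, this]

lemma compilesUpToControlled_of_onAux_mul {n : ℕ} {U : Op2} (g : unitaryGroup (Fin 2) ℂ)
    (h : CompilesUpToControlled n ((Gate.onAux g).mat * U)) : CompilesUpToControlled n U := by
  simpa [onAux_star_mul, Gate.cnots] using h.gate_mul (.onAux (star g))

lemma compilesUpToControlled_of_onSys_mul {n : ℕ} {U : Op2} (g : unitaryGroup (Fin 2) ℂ)
    (h : CompilesUpToControlled n ((Gate.onSys g).mat * U)) : CompilesUpToControlled n U := by
  simpa [onSys_star_mul, Gate.cnots] using h.gate_mul (.onSys (star g))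

lemma compilesUpToControlled_of_mul_onSys {n : ℕ} {U : Op2} (g : unitaryGroup (Fin 2) ℂ)
    (h : CompilesUpToControlled n (U * (Gate.onSys g).mat)) : CompilesUpToControlled n U := by
  simpa [mul_onSys_star] using h.mul_onSys (star g)

/-- The unitary that applies `Q` to the auxiliary qubit if the system qubit is in state `1`. -/
def controlledBySys (Q : Op1) : Op2 :=
  (1 : Op1) ⊗ₖ (Matrix.single 0 0 1 : Op1) + Q ⊗ₖ (Matrix.single 1 1 1 : Op1)

lemma controlledBySys_mul (A B : Op1) :
    controlledBySys A * controlledBySys B = controlledBySys (A * B) := by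
  ext ⟨i, j⟩ ⟨k, l⟩
  fin_cases i <;> fin_cases j <;> fin_cases k <;> fin_cases l <;>
    simp [controlledBySys, Matrix.mul_apply, Fintype.sum_prod_type, Matrix.single, Matrix.one_apply]

lemma controlledBySys_one : controlledBySys 1 = 1 := by
  ext ⟨i, j⟩ ⟨k, l⟩
  fin_cases i <;> fin_cases j <;> fin_cases k <;> fin_cases l <;>
    simp [controlledBySys, Matrix.single]

lemma conjTranspose_controlledBySys (A : Op1) : (controlledBySys A)ᴴ = controlledBySys Aᴴ := by
  ext ⟨i, j⟩ ⟨k, l⟩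
  fin_cases i <;> fin_cases j <;> fin_cases k <;> fin_cases l <;>
    simp [controlledBySys, Matrix.single, Matrix.conjTranspose_apply]

lemma controlledBySys_mem_unitaryGroup {Q : Op1} (hQ : Q ∈ unitaryGroup (Fin 2) ℂ) :
    controlledBySys Q ∈ unitaryGroup (Fin 2 × Fin 2) ℂ := by
  rw [mem_unitaryGroup_iff, star_eq_conjTranspose, conjTranspose_controlledBySys,
    controlledBySys_mul, ← star_eq_conjTranspose, mem_unitaryGroup_iff.1 hQ, controlledBySys_one]

/-! ### Controlled conjugates of X at the cost of one CNOT -/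

lemma conj_pauliX_mul_self {g : Op1} (hg : g ∈ unitaryGroup (Fin 2) ℂ) :
    (g * pauliX * gᴴ) * (g * pauliX * gᴴ) = 1 := by
  have h : gᴴ * g = 1 := mem_unitaryGroup_iff'.1 hg
  have h' : g * gᴴ = 1 := mem_unitaryGroup_iff.1 hg
  calc (g * pauliX * gᴴ) * (g * pauliX * gᴴ) = g * pauliX * (gᴴ * g) * pauliX * gᴴ := by
        simp only [Matrix.mul_assoc]
    _ = g * (pauliX * pauliX) * gᴴ := by rw [h, Matrix.mul_one, Matrix.mul_assoc g]
    _ = 1 := by rw [pauliX_mul_self, Matrix.mul_one, h']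

lemma onSys_mul_cnotAuxSys_mul {g : Op1} (hg : g ∈ unitaryGroup (Fin 2) ℂ) (V : Op2) :
    (Gate.onSys ⟨g, hg⟩).mat * (Gate.cnotAuxSys.mat * ((Gate.onSys (star ⟨g, hg⟩)).mat * V))
      = controlled (g * pauliX * gᴴ) * V := by
  have h : g * gᴴ = 1 := mem_unitaryGroup_iff.1 hg
  have key : controlled (g * pauliX * gᴴ) =
      (1 : Op1) ⊗ₖ g * controlled pauliX * ((1 : Op1) ⊗ₖ gᴴ) := by
    simp only [controlled, Matrix.mul_add, Matrix.add_mul, ← mul_kronecker_mul, Matrix.one_mul,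
      Matrix.mul_one, h]
  rw [key, Matrix.mul_assoc, Matrix.mul_assoc]
  rfl

/-- Controlling a conjugate of X takes one CNOT between local gates, and the resulting gate is its
own inverse. The eliminations therefore use such conjugates instead of arbitrary unitaries. -/
lemma compilesUpToControlled_succ_of_controlled_mul {n : ℕ} {U : Op2} {g : Op1}
    (hg : g ∈ unitaryGroup (Fin 2) ℂ)
    (h : CompilesUpToControlled n (controlled (g * pauliX * gᴴ) * U)) :
    CompilesUpToControlled (n + 1) U := by
  have h2 := ((h.gate_mul (.onSys (star ⟨g, hg⟩))).gate_mul .cnotAuxSys).gate_mul (.onSys ⟨g, hg⟩)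
  rw [onSys_mul_cnotAuxSys_mul, ← Matrix.mul_assoc, controlled_mul, conj_pauliX_mul_self hg,
    controlled_one, Matrix.one_mul] at h2
  simpa [Gate.cnots, add_comm] using h2

lemma onAux_mul_cnotSysAux_mul {g : Op1} (hg : g ∈ unitaryGroup (Fin 2) ℂ) (V : Op2) :
    (Gate.onAux ⟨g, hg⟩).mat * (Gate.cnotSysAux.mat * ((Gate.onAux (star ⟨g, hg⟩)).mat * V))
      = controlledBySys (g * pauliX * gᴴ) * V := by
  have h : g * gᴴ = 1 := mem_unitaryGroup_iff.1 hg
  have key : controlledBySys (g * pauliX * gᴴ) =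
      g ⊗ₖ (1 : Op1) * controlledBySys pauliX * (gᴴ ⊗ₖ (1 : Op1)) := by
    simp only [controlledBySys, Matrix.mul_add, Matrix.add_mul, ← mul_kronecker_mul, Matrix.one_mul,
      Matrix.mul_one, h]
  rw [key, Matrix.mul_assoc, Matrix.mul_assoc]
  rfl

lemma compilesUpToControlled_succ_of_controlledBySys_mul {n : ℕ} {U : Op2} {g : Op1}
    (hg : g ∈ unitaryGroup (Fin 2) ℂ)
    (h : CompilesUpToControlled n (controlledBySys (g * pauliX * gᴴ) * U)) :
    CompilesUpToControlled (n + 1) U := by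
  have h2 := ((h.gate_mul (.onAux (star ⟨g, hg⟩))).gate_mul .cnotSysAux).gate_mul (.onAux ⟨g, hg⟩)
  rw [onAux_mul_cnotSysAux_mul, ← Matrix.mul_assoc, controlledBySys_mul, conj_pauliX_mul_self hg,
    controlledBySys_one, Matrix.one_mul] at h2
  simpa [Gate.cnots, add_comm] using h2

/-! ### Reduction of the first two columns -/

lemma conjTranspose_mem_unitaryGroup {U : Op2} (hU : U ∈ unitaryGroup (Fin 2 × Fin 2) ℂ) :
    Uᴴ ∈ unitaryGroup (Fin 2 × Fin 2) ℂ :=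
  (star (⟨U, hU⟩ : unitaryGroup (Fin 2 × Fin 2) ℂ)).2

lemma sum_normSq_row {U : Op2} (hU : U ∈ unitaryGroup (Fin 2 × Fin 2) ℂ) (a : Fin 2 × Fin 2) :
    ∑ x, normSq (U a x) = 1 := by
  have h : ∑ x, U a x * star (U a x) = 1 := by
    rw [← Matrix.one_apply_eq a, ← mem_unitaryGroup_iff.1 hU, Matrix.mul_apply]
    rfl
  simp only [star_def, mul_conj] at h
  exact_mod_cast h

/-- In a unitary, an entry of modulus one is the only nonzero entry of its row. -/
lemma apply_eq_zero_of_row {U : Op2} (hU : U ∈ unitaryGroup (Fin 2 × Fin 2) ℂ)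
    {a b c : Fin 2 × Fin 2} (h : normSq (U a b) = 1) (hcb : c ≠ b) : U a c = 0 := by
  have h2 := sum_normSq_row hU a
  rw [← Finset.add_sum_erase _ _ (Finset.mem_univ b), h, add_eq_left,
    Finset.sum_eq_zero_iff_of_nonneg fun _ _ => normSq_nonneg _] at h2
  exact normSq_eq_zero.1 (h2 c (by simp [hcb]))

/-- In a unitary, an entry of modulus one is the only nonzero entry of its column. -/
lemma apply_eq_zero_of_col {U : Op2} (hU : U ∈ unitaryGroup (Fin 2 × Fin 2) ℂ)
    {a b c : Fin 2 × Fin 2} (h : normSq (U a b) = 1) (hca : c ≠ a) : U c b = 0 := by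
  have := apply_eq_zero_of_row (conjTranspose_mem_unitaryGroup hU) (a := b) (b := a) (c := c)
    (by simpa using h) hca
  simpa using this

lemma normSq_apply_eq_one {U : Op2} (hU : U ∈ unitaryGroup (Fin 2 × Fin 2) ℂ)
    {a b : Fin 2 × Fin 2} (h : ∀ c, c ≠ a → U c b = 0) : normSq (U a b) = 1 := by
  have h2 := sum_normSq_row (conjTranspose_mem_unitaryGroup hU) b
  rw [← Finset.add_sum_erase _ _ (Finset.mem_univ a), Finset.sum_eq_zero] at h2
  · simpa using h2
  · intro c hc
    simp [h c (Finset.ne_of_mem_erase hc)]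

/-! ### Action of the gates on matrix entries -/

lemma controlled_mul_apply_zero (Q : Op1) (U : Op2) (j : Fin 2) (c : Fin 2 × Fin 2) :
    (controlled Q * U) (0, j) c = U (0, j) c := by
  fin_cases j <;>
    simp [controlled, Matrix.mul_apply, Fintype.sum_prod_type, Matrix.single, Matrix.one_apply]

lemma controlled_mul_apply_one (Q : Op1) (U : Op2) (j : Fin 2) (c : Fin 2 × Fin 2) :
    (controlled Q * U) (1, j) c = Q j 0 * U (1, 0) c + Q j 1 * U (1, 1) c := by
  fin_cases j <;>
    simp [controlled, Matrix.mul_apply, Fintype.sum_prod_type, Matrix.single]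

lemma controlledBySys_mul_apply_zero (Q : Op1) (U : Op2) (i : Fin 2) (c : Fin 2 × Fin 2) :
    (controlledBySys Q * U) (i, 0) c = U (i, 0) c := by
  fin_cases i <;>
    simp [controlledBySys, Matrix.mul_apply, Fintype.sum_prod_type, Matrix.single,
      Matrix.one_apply]

lemma controlledBySys_mul_apply_one (Q : Op1) (U : Op2) (i : Fin 2) (c : Fin 2 × Fin 2) :
    (controlledBySys Q * U) (i, 1) c = Q i 0 * U (0, 1) c + Q i 1 * U (1, 1) c := by
  fin_cases i <;>
    simp [controlledBySys, Matrix.mul_apply, Fintype.sum_prod_type, Matrix.single]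

lemma onAux_mul_apply (g : unitaryGroup (Fin 2) ℂ) (U : Op2) (i j : Fin 2) (c : Fin 2 × Fin 2) :
    ((Gate.onAux g).mat * U) (i, j) c = g.1 i 0 * U (0, j) c + g.1 i 1 * U (1, j) c := by
  fin_cases j <;>
    simp [Gate.mat, Matrix.mul_apply, Fintype.sum_prod_type, Matrix.one_apply]

lemma onSys_mul_apply (g : unitaryGroup (Fin 2) ℂ) (U : Op2) (i j : Fin 2) (c : Fin 2 × Fin 2) :
    ((Gate.onSys g).mat * U) (i, j) c = g.1 j 0 * U (i, 0) c + g.1 j 1 * U (i, 1) c := by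
  fin_cases i <;>
    simp [Gate.mat, Matrix.mul_apply, Fintype.sum_prod_type, Matrix.one_apply]

lemma mul_onSys_apply (g : unitaryGroup (Fin 2) ℂ) (U : Op2) (i j : Fin 2) (c : Fin 2 × Fin 2) :
    (U * (Gate.onSys g).mat) c (i, j) = U c (i, 0) * g.1 0 j + U c (i, 1) * g.1 1 j := by
  fin_cases i <;>
    simp [Gate.mat, Matrix.mul_apply, Fintype.sum_prod_type, Matrix.one_apply]

lemma onAux_mem_unitaryGroup (g : unitaryGroup (Fin 2) ℂ) :
    (Gate.onAux g).mat ∈ unitaryGroup (Fin 2 × Fin 2) ℂ :=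
  kronecker_mem_unitary g.2 (one_mem _)

lemma onSys_mem_unitaryGroup (g : unitaryGroup (Fin 2) ℂ) :
    (Gate.onSys g).mat ∈ unitaryGroup (Fin 2 × Fin 2) ℂ :=
  kronecker_mem_unitary (one_mem _) g.2

/-- Unitarity clears the rest of the two rows and columns, so `U` is `controlled R`. Taking `Q = Rᴴ`
leaves the empty circuit. -/
lemma compilesUpToControlled_zero_of_apply_eq_one {U : Op2}
    (hU : U ∈ unitaryGroup (Fin 2 × Fin 2) ℂ) (h0 : U (0, 0) (0, 0) = 1)
    (h1 : U (0, 1) (0, 1) = 1) : CompilesUpToControlled 0 U := by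
  set R : Op1 := of fun i j => U (1, i) (1, j) with hR
  have hUR : U = controlled R := by
    ext a ⟨i, j⟩
    by_cases ha0 : a = (0, 0)
    · subst ha0
      by_cases hb : (i, j) = (0, 0)
      · rw [hb, h0]
        simp [controlled]
      · rw [apply_eq_zero_of_row hU (b := (0, 0)) (by simp [h0]) hb]
        fin_cases i <;> fin_cases j <;> simp_all [controlled]
    by_cases ha1 : a = (0, 1)
    · subst ha1
      by_cases hb : (i, j) = (0, 1)
      · rw [hb, h1]
        simp [controlled]
      · rw [apply_eq_zero_of_row hU (b := (0, 1)) (by simp [h1]) hb]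
        fin_cases i <;> fin_cases j <;> simp_all [controlled]
    have h2 := apply_eq_zero_of_col hU (a := (0, 0)) (b := (0, 0)) (by simp [h0]) ha0
    have h3 := apply_eq_zero_of_col hU (a := (0, 1)) (b := (0, 1)) (by simp [h1]) ha1
    obtain ⟨k, l⟩ := a
    fin_cases k <;> fin_cases l <;> fin_cases i <;> fin_cases j <;> simp_all [controlled]
  have hone : R * Rᴴ = 1 := by
    have h : controlled (R * Rᴴ) = 1 := by
      rw [← controlled_mul, ← conjTranspose_controlled, ← hUR]
      exact mem_unitaryGroup_iff.1 hU
    ext i j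
    have := congrFun₂ h (1, i) (1, j)
    simpa [controlled, Matrix.one_apply] using this
  refine ⟨Rᴴ, mem_unitaryGroup_iff'.2 (by simpa [star_eq_conjTranspose] using hone), [], ?_, rfl⟩
  rw [hUR, controlled_mul, hone, controlled_one]
  rfl

lemma compilesUpToControlled_zero {U : Op2} (hU : U ∈ unitaryGroup (Fin 2 × Fin 2) ℂ)
    (h0 : normSq (U (0, 0) (0, 0)) = 1) (h1 : normSq (U (0, 1) (0, 1)) = 1) :
    CompilesUpToControlled 0 U := by
  have h0' : U (0, 0) (0, 0) * star (U (0, 0) (0, 0)) = 1 := by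
    rw [star_def, mul_conj, h0, ofReal_one]
  have h1' : U (0, 1) (0, 1) * star (U (0, 1) (0, 1)) = 1 := by
    rw [star_def, mul_conj, h1, ofReal_one]
  have hd : !![star (U (0, 0) (0, 0)), 0; 0, star (U (0, 1) (0, 1))] ∈ unitaryGroup (Fin 2) ℂ := by
    rw [mem_unitaryGroup_iff']
    ext i j
    fin_cases i <;> fin_cases j <;>
      simp [star_eq_conjTranspose, Matrix.mul_apply, Fin.sum_univ_two] <;> assumption
  refine compilesUpToControlled_of_mul_onSys ⟨_, hd⟩
    (compilesUpToControlled_zero_of_apply_eq_one (mul_mem hU (onSys_mem_unitaryGroup _)) ?_ ?_)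
  · rw [mul_onSys_apply]
    simpa using h0'
  · rw [mul_onSys_apply]
    simpa using h1'

/-- The entries left in the second column, (0,1) and (1,1), share system value 1. A gate controlled
by the system qubit merges them and leaves the row (0,0) alone. -/
lemma compilesUpToControlled_one {U : Op2} (hU : U ∈ unitaryGroup (Fin 2 × Fin 2) ℂ)
    (h0 : normSq (U (0, 0) (0, 0)) = 1) (h1 : U (1, 0) (0, 1) = 0) :
    CompilesUpToControlled 1 U := by
  obtain ⟨g, hg, h⟩ := exists_conj_pauliX_row_one (U (0, 1) (0, 1)) (U (1, 1) (0, 1))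
  have hV := mul_mem (controlledBySys_mem_unitaryGroup (conj_pauliX_mem_unitaryGroup hg)) hU
  refine compilesUpToControlled_succ_of_controlledBySys_mul hg
    (compilesUpToControlled_zero hV ?_ ?_)
  · rwa [controlledBySys_mul_apply_zero]
  · refine normSq_apply_eq_one hV ?_
    rintro ⟨i, j⟩ hij
    fin_cases i <;> fin_cases j
    · simpa [controlledBySys_mul_apply_zero] using apply_eq_zero_of_row hU h0 (c := (0, 1)) (by simp)
    · simp at hij
    · simpa [controlledBySys_mul_apply_zero] using h1
    · simpa [controlledBySys_mul_apply_one] using h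

/-- The entries (1,0) and (1,1) share auxiliary value 1, so a gate controlled by the auxiliary qubit
can clear (1,0) without touching the row (0,0). -/
lemma compilesUpToControlled_two {U : Op2} (hU : U ∈ unitaryGroup (Fin 2 × Fin 2) ℂ)
    (h0 : normSq (U (0, 0) (0, 0)) = 1) : CompilesUpToControlled 2 U := by
  obtain ⟨g, hg, h⟩ := exists_conj_pauliX_row_zero (U (1, 0) (0, 1)) (U (1, 1) (0, 1))
  have hV := mul_mem (controlled_mem_unitaryGroup (conj_pauliX_mem_unitaryGroup hg)) hU
  refine compilesUpToControlled_succ_of_controlled_mul hg (compilesUpToControlled_one hV ?_ ?_)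
  · rwa [controlled_mul_apply_zero]
  · rwa [controlled_mul_apply_one]

/-- Some superposition of two vectors of `ℂ² ⊗ ℂ²` is a product vector. -/
lemma exists_normalized_det_eq_zero (a b : Fin 2 × Fin 2 → ℂ) :
    ∃ x y : ℂ, normSq x + normSq y = 1 ∧
      (a (0, 0) * x + b (0, 0) * y) * (a (1, 1) * x + b (1, 1) * y) =
        (a (0, 1) * x + b (0, 1) * y) * (a (1, 0) * x + b (1, 0) * y) := by
  -- If the leading coefficient vanishes, `a` is itself a product vector. Otherwise a root `z` of
  -- the quadratic is the ratio x : y, and `r` normalizes (z, 1).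
  by_cases hA : a (0, 0) * a (1, 1) - a (0, 1) * a (1, 0) = 0
  · exact ⟨1, 0, by simp, by linear_combination hA⟩
  set B := a (0, 0) * b (1, 1) + b (0, 0) * a (1, 1) - a (0, 1) * b (1, 0) - b (0, 1) * a (1, 0)
    with hB
  set C := b (0, 0) * b (1, 1) - b (0, 1) * b (1, 0) with hC
  obtain ⟨z, hz⟩ := exists_quadratic_eq_zero hA (b := B) (c := C)
    ((IsAlgClosed.exists_pow_nat_eq (discrim _ B C) two_pos).imp fun s hs => by rw [← hs, sq])
  set r : ℝ := √(normSq z + 1) with hr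
  have hr2 : r * r = normSq z + 1 := Real.mul_self_sqrt (by linarith [normSq_nonneg z])
  have hr0 : r * r ≠ 0 := by rw [hr2]; linarith [normSq_nonneg z]
  refine ⟨z / r, 1 / r, ?_, ?_⟩
  · rw [normSq_div, normSq_div, normSq_ofReal, normSq_one, ← add_div, ← hr2, div_self hr0]
  · have hr1 : (r : ℂ) ≠ 0 := by exact_mod_cast left_ne_zero_of_mul hr0
    field_simp
    linear_combination hz

/-- If a column of a unitary is a product vector, then local gates take it to a multiple of the
first basis vector. -/
lemma exists_local_of_det_eq_zero {U : Op2} (hU : U ∈ unitaryGroup (Fin 2 × Fin 2) ℂ)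
    {c : Fin 2 × Fin 2} (hd : U (0, 0) c * U (1, 1) c = U (0, 1) c * U (1, 0) c) :
    ∃ g h : unitaryGroup (Fin 2) ℂ,
      normSq (((Gate.onSys h).mat * ((Gate.onAux g).mat * U)) (0, 0) c) = 1 := by
  -- Read as a 2 × 2 matrix, the column has rank at most one, so a row that annihilates one nonzero
  -- column of that matrix annihilates the other too.
  obtain ⟨g, hg0, hg1⟩ : ∃ g : unitaryGroup (Fin 2) ℂ,
      g.1 1 0 * U (0, 0) c + g.1 1 1 * U (1, 0) c = 0 ∧
      g.1 1 0 * U (0, 1) c + g.1 1 1 * U (1, 1) c = 0 := by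
    by_cases h0 : U (0, 0) c = 0 ∧ U (1, 0) c = 0
    · obtain ⟨g, hg, h⟩ := exists_conj_pauliX_row_one (U (0, 1) c) (U (1, 1) c)
      exact ⟨⟨_, conj_pauliX_mem_unitaryGroup hg⟩, by simp [h0.1, h0.2], h⟩
    · obtain ⟨g, hg, h⟩ := exists_conj_pauliX_row_one (U (0, 0) c) (U (1, 0) c)
      have hG := conj_pauliX_mem_unitaryGroup hg
      generalize g * pauliX * gᴴ = G at h hG
      refine ⟨⟨G, hG⟩, h, ?_⟩
      dsimp only
      by_cases h1 : U (0, 0) c = 0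
      · refine (mul_eq_zero.1 ?_).resolve_left fun h2 => h0 ⟨h1, h2⟩
        linear_combination U (1, 1) c * h - G 1 0 * hd
      · refine (mul_eq_zero.1 ?_).resolve_left h1
        linear_combination U (0, 1) c * h + G 1 1 * hd
  set V := (Gate.onAux g).mat * U with hVdef
  have hV : V ∈ unitaryGroup (Fin 2 × Fin 2) ℂ := mul_mem (onAux_mem_unitaryGroup g) hU
  obtain ⟨h, hh, hh0⟩ := exists_conj_pauliX_row_one (V (0, 0) c) (V (0, 1) c)
  refine ⟨g, ⟨_, conj_pauliX_mem_unitaryGroup hh⟩,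
    normSq_apply_eq_one (mul_mem (onSys_mem_unitaryGroup _) hV) ?_⟩
  have hV0 : V (1, 0) c = 0 := by rw [hVdef, onAux_mul_apply, hg0]
  have hV1 : V (1, 1) c = 0 := by rw [hVdef, onAux_mul_apply, hg1]
  rintro ⟨i, j⟩ hij
  rw [onSys_mul_apply]
  fin_cases i
  · fin_cases j
    · simp at hij
    · exact hh0
  · simp [hV0, hV1]

lemma compilesUpToControlled_two_of_mem_unitaryGroup {U : Op2}
    (hU : U ∈ unitaryGroup (Fin 2 × Fin 2) ℂ) : CompilesUpToControlled 2 U := by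
  obtain ⟨x, y, hxy, hd⟩ := exists_normalized_det_eq_zero (U · (0, 0)) (U · (0, 1))
  -- The first column of `k` is (x, y), so the product superposition becomes the first column of the
  -- new matrix.
  set k : unitaryGroup (Fin 2) ℂ := ⟨_, mem_unitaryGroup_of_normSq hxy⟩ with hk
  have hV := mul_mem hU (onSys_mem_unitaryGroup k)
  have hd' : (U * (Gate.onSys k).mat) (0, 0) (0, 0) * (U * (Gate.onSys k).mat) (1, 1) (0, 0)
      = (U * (Gate.onSys k).mat) (0, 1) (0, 0) * (U * (Gate.onSys k).mat) (1, 0) (0, 0) := by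
    simpa [mul_onSys_apply, hk] using hd
  obtain ⟨g, h, hgh⟩ := exists_local_of_det_eq_zero hV hd'
  exact compilesUpToControlled_of_mul_onSys k <| compilesUpToControlled_of_onAux_mul g <|
    compilesUpToControlled_of_onSys_mul h <| compilesUpToControlled_two
      (mul_mem (onSys_mem_unitaryGroup h) (mul_mem (onAux_mem_unitaryGroup g) hV)) hgh

end QubitPOVM

theorem proposition1 (P : Fin 2 × Fin 2 → QubitPOVM.Op1) (hP : QubitPOVM.IsRankOnePOVM P)
    (U : QubitPOVM.Op2) (hU : QubitPOVM.IsDilation U P) :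
    ∃ (γ : Fin 4 → ℝ) (β : Fin 3 → ℝ),
      QubitPOVM.IsDilation (QubitPOVM.adjust U γ β) P ∧
        QubitPOVM.CompilesWith 2 (QubitPOVM.adjust U γ β) := by
  obtain ⟨Q, hQ, hc⟩ := QubitPOVM.compilesUpToControlled_two_of_mem_unitaryGroup hU.unitary
  obtain ⟨γ, rfl⟩ := QubitPOVM.exists_gateQ_eq hQ
  refine ⟨γ, 0, ?_⟩
  rw [QubitPOVM.adjust, QubitPOVM.gatePh_zero, Matrix.one_mul]
  exact ⟨hU.mul_controlled hQ, hc⟩
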